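/- Let $H$ be a complex Hilbert space, let $0<p\le 1$ and $k\in\mathbb{N}$ ($k=0$ allowed), and let $T$ be a bounded linear operator on $H$ that is $(p,k)$-quasihyponormal, that is, $$T^{*k}\bigl((T^{*}T)^{p}-(TT^{*})^{p}\bigr)T^{k}\ \ge\ 0 .$$ Then: 1. $T$ has Bishop's property $(\beta)$: for every open set $D\subseteq\mathbb{C}$ and every sequence of analytic functions $f_n\colon D\to H$ such that $(T-z)f_n(z)\to 0$ uniformly on every compact subset of $D$, one has $f_n(z)\to 0$ uniformly on every compact subset of $D$. 2. $T$ consequently has the single valued extension property: for every open set $D\subseteq\mathbb{C}$, the only analytic function $f\colon D\to H$ with $(T-z)f(z)=0$ for all $z\in D$ is $f\equiv 0$. -/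

import Mathlib

open Filter

/-- `T` is `(p; k)`-quasihyponormal: `T*^k ((T* T)^p - (T T*)^p) T^k ≥ 0`.
Products of operators are compositions, `star T` is the Hilbert space adjoint, the real powers
of the positive operators `T* T` and `T T*` are those of the continuous functional calculus, and
`0 ≤ S` is the Loewner order (`S` is a positive operator). -/
def IsPKQuasihyponormal {H : Type*} [NormedAddCommGroup H] [InnerProductSpace ℂ H]
    [CompleteSpace H] (p : ℝ) (k : ℕ) (T : H →L[ℂ] H) : Prop :=
  0 ≤ (star T) ^ k * ((star T * T) ^ p - (T * star T) ^ p) * T ^ k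

/-- Bishop's property `(β)`: for every open `D ⊆ ℂ` and every sequence of analytic functions
`f n : D → H`, if `(T - z) f n z → 0` uniformly on every compact subset of `D`, then
`f n z → 0` uniformly on every compact subset of `D`. -/
def HasBishopPropertyBeta {H : Type*} [NormedAddCommGroup H] [NormedSpace ℂ H]
    (T : H →L[ℂ] H) : Prop :=
  ∀ (D : Set ℂ) (f : ℕ → ℂ → H), IsOpen D → (∀ n, AnalyticOnNhd ℂ (f n) D) →
    (∀ K : Set ℂ, K ⊆ D → IsCompact K →
      TendstoUniformlyOn (fun n z => T (f n z) - z • f n z) (fun _ => 0) atTop K) →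
    ∀ K : Set ℂ, K ⊆ D → IsCompact K →
      TendstoUniformlyOn f (fun _ => 0) atTop K

/-- The single valued extension property: for every open `D ⊆ ℂ`, the only analytic function
`f : D → H` with `(T - z) f z = 0` on `D` is the zero function. -/
def HasSingleValuedExtensionProperty {H : Type*} [NormedAddCommGroup H] [NormedSpace ℂ H]
    (T : H →L[ℂ] H) : Prop :=
  ∀ (D : Set ℂ) (f : ℂ → H), IsOpen D → AnalyticOnNhd ℂ f D →
    (∀ z ∈ D, T (f z) - z • f z = 0) → ∀ z ∈ D, f z = 0

/-!
Write `A = T* T` and `B = T T*`. The key point is an estimate of Hölder type: if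
`⟪(A ^ p - B ^ p) x, x⟫ ≥ 0` and `z` is bounded, then
`‖(A - |z|²) x‖² ≤ C ‖(T - z) x‖ ‖x‖`.
Indeed `(t - s) (t ^ p - s ^ p) ≥ κ (t - s)²` on bounded intervals, so with `s = |z|²` the left hand
side is at most a multiple of
`⟪(A - s) (A ^ p - s ^ p) x, x⟫ = ⟪B ^ p T x, T x⟫ - s ^ p ‖T x‖² - s ⟪A ^ p x, x⟫ + s ^ (p + 1) ‖x‖²`,
where `T A ^ p = B ^ p T` was used. Replacing `T x` by `z x` turns the right hand side into
`- s ⟪(A ^ p - B ^ p) x, x⟫ ≤ 0`, and costs at most `C ‖(T - z) x‖ ‖x‖`. This is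
`norm_sub_sq_smul_le`; quasihyponormality supplies its hypothesis for every `x` in the range of
`T ^ k`.

For analytic `g`, Cauchy's formula recovers `g` from `(A - |w|²) g(w)`, since on the circle
`|w - c| = r` the conjugate of `w` is `conj c + r² / (w - c)`: the mean of `(A - |w|²) g(w)` against
`dw` is a multiple of `c g(c)` (`norm_mul_norm_le_of_sphere`). So `g(c)`, `c ≠ 0`, is bounded by
`sup (‖(T - w) g(w)‖ ‖g(w)‖) ^ (1/2)` over a circle. The factor `‖g(w)‖ ^ (1/2)` is absorbed by
evaluating at a point where `(ρ - |w - c|)² ‖g(w)‖` is largest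
(`norm_le_of_norm_sub_sq_smul_le`), which yields `sup ‖g‖ ≤ C sup ‖(T - w) g(w)‖` on a smaller disc
away from `0`. Applied to `g = T ^ k f`, which differs from `w ^ k f` by `O(‖(T - w) f(w)‖)`, this
gives property `(β)` on `D \ {0}`, and the maximum principle on a circle around `0` removes the
exceptional point. The single valued extension property is property `(β)` for constant sequences.
-/

open scoped InnerProductSpace ComplexConjugate

/-! ### Functional calculus of `T* T` and `T T*` -/

/-- Intertwining `a f(a* a) = f(a a*) a`: clear for polynomials, and passed to continuous `f` by
Weierstrass approximation on an interval containing both spectra. -/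
theorem mul_cfc_star_mul_self {𝒜 : Type*} [CStarAlgebra 𝒜] [PartialOrder 𝒜] [StarOrderedRing 𝒜]
    (a : 𝒜) {f : ℝ → ℝ} (hf : Continuous f) :
    a * cfc f (star a * a) = cfc f (a * star a) * a := by
  have hA : IsSelfAdjoint (star a * a) := .star_mul_self a
  have hB : IsSelfAdjoint (a * star a) := .mul_star_self a
  have hpoly (q : Polynomial ℝ) :
      a * Polynomial.aeval (star a * a) q = Polynomial.aeval (a * star a) q * a := by
    induction q using Polynomial.induction_on' with
    | add p q hp hq => simp only [map_add, mul_add, add_mul, hp, hq]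
    | monomial n r =>
      have : a * (star a * a) ^ n = (a * star a) ^ n * a :=
        (show SemiconjBy a (star a * a) (a * star a) from (mul_assoc _ _ _).symm).pow_right n
      rw [Polynomial.aeval_monomial, Polynomial.aeval_monomial, ← mul_assoc,
        ← Algebra.commutes, mul_assoc, this, mul_assoc]
  obtain ⟨M, hM⟩ : ∃ M : ℝ, ∀ b ∈ ({star a * a, a * star a} : Set 𝒜), ‖b‖ * ‖(1 : 𝒜)‖ ≤ M :=
    ⟨max (‖star a * a‖ * ‖(1 : 𝒜)‖) (‖a * star a‖ * ‖(1 : 𝒜)‖), by simp⟩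
  have hspec (b : 𝒜) (hb : b ∈ ({star a * a, a * star a} : Set 𝒜)) :
      spectrum ℝ b ⊆ Set.Icc (-M) M := fun t ht =>
    abs_le.1 ((spectrum.norm_le_norm_mul_of_mem ht).trans (hM b hb))
  rw [← sub_eq_zero, ← norm_le_zero_iff]
  refine le_of_forall_pos_le_add fun ε hε => ?_
  obtain ⟨q, hq⟩ := exists_polynomial_near_of_continuousOn (-M) M f hf.continuousOn
    (ε / (2 * (‖a‖ + 1))) (by positivity)
  have happ (b : 𝒜) (hb : b ∈ ({star a * a, a * star a} : Set 𝒜)) (hsa : IsSelfAdjoint b) :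
      ‖cfc f b - Polynomial.aeval b q‖ ≤ ε / (2 * (‖a‖ + 1)) := by
    rw [← cfc_polynomial q b, ← cfc_sub f q.eval b hf.continuousOn q.continuousOn]
    refine norm_cfc_le (by positivity) fun t ht => ?_
    rw [Real.norm_eq_abs, abs_sub_comm]
    exact (hq t (hspec b hb ht)).le
  have h1 := happ _ (by simp) hA
  have h2 := happ _ (by simp) hB
  calc ‖a * cfc f (star a * a) - cfc f (a * star a) * a‖
      = ‖a * (cfc f (star a * a) - Polynomial.aeval (star a * a) q)
          - (cfc f (a * star a) - Polynomial.aeval (a * star a) q) * a‖ := by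
        rw [mul_sub, sub_mul, hpoly, sub_sub_sub_cancel_right]
    _ ≤ ‖a‖ * (ε / (2 * (‖a‖ + 1))) + (ε / (2 * (‖a‖ + 1))) * ‖a‖ := by
        refine (norm_sub_le _ _).trans (add_le_add ?_ ?_)
        · exact (norm_mul_le _ _).trans (by gcongr)
        · exact (norm_mul_le _ _).trans (by gcongr)
    _ = ε * (‖a‖ / (‖a‖ + 1)) := by field_simp; ring
    _ ≤ 0 + ε := by
        rw [zero_add]
        exact mul_le_of_le_one_right hε.le ((div_le_one (by positivity)).2 (by linarith))

theorem mul_rpow_star_mul_self {𝒜 : Type*} [CStarAlgebra 𝒜] [PartialOrder 𝒜] [StarOrderedRing 𝒜]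
    (a : 𝒜) {p : ℝ} (hp : 0 ≤ p) :
    a * (star a * a) ^ p = (a * star a) ^ p * a := by
  rw [CFC.rpow_eq_cfc_real (star_mul_self_nonneg a), CFC.rpow_eq_cfc_real (mul_star_self_nonneg a)]
  exact mul_cfc_star_mul_self a (Real.continuous_rpow_const hp)

/-- Strong monotonicity of `t ↦ t ^ p` on `[0, M]`, from Bernoulli's inequality
`(s / t) ^ p ≤ 1 + p (s / t - 1)` for `s ≤ t`. -/
theorem mul_sub_sq_le_sub_mul_rpow_sub {p M s t : ℝ} (hp0 : 0 < p) (hp1 : p ≤ 1)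
    (hs : s ∈ Set.Icc 0 M) (ht : t ∈ Set.Icc 0 M) :
    p * M ^ (p - 1) * (t - s) ^ 2 ≤ (t - s) * (t ^ p - s ^ p) := by
  wlog hst : s ≤ t generalizing s t
  · linarith [this ht hs (le_of_not_ge hst)]
  rcases hst.eq_or_lt with rfl | hlt
  · simp
  have ht0 : 0 < t := hs.1.trans_lt hlt
  have hbern : (s / t) ^ p ≤ 1 + p * (s / t - 1) := by
    have := rpow_one_add_le_one_add_mul_self (s := s / t - 1)
      (by have := div_nonneg hs.1 ht0.le; linarith) hp0.le hp1
    rwa [add_sub_cancel] at this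
  have hmono : M ^ (p - 1) ≤ t ^ (p - 1) :=
    Real.rpow_le_rpow_of_nonpos ht0 ht.2 (by linarith)
  have hts : t ^ (p - 1) * t = t ^ p := by
    rw [← Real.rpow_add_one ht0.ne', sub_add_cancel]
  have key : p * t ^ (p - 1) * (t - s) ≤ t ^ p - s ^ p := by
    rw [Real.div_rpow hs.1 ht0.le, div_le_iff₀ (by positivity)] at hbern
    have : (1 + p * (s / t - 1)) * t ^ p = t ^ p - p * t ^ (p - 1) * (t - s) := by
      rw [← hts]; field_simp; ring
    linarith
  have hd : 0 ≤ t - s := by linarith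
  calc p * M ^ (p - 1) * (t - s) ^ 2 ≤ p * t ^ (p - 1) * (t - s) ^ 2 := by gcongr
    _ = (t - s) * (p * t ^ (p - 1) * (t - s)) := by ring
    _ ≤ _ := by gcongr

theorem smul_sub_sq_le_sub_mul_rpow_sub {𝒜 : Type*} [CStarAlgebra 𝒜] [PartialOrder 𝒜]
    [StarOrderedRing 𝒜] {a : 𝒜} (ha : 0 ≤ a) {p M s : ℝ} (hp0 : 0 < p) (hp1 : p ≤ 1)
    (hs : s ∈ Set.Icc 0 M) (haM : ‖a‖ * ‖(1 : 𝒜)‖ ≤ M) :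
    (p * M ^ (p - 1)) • (a - algebraMap ℝ 𝒜 s) ^ 2 ≤
      (a - algebraMap ℝ 𝒜 s) * (a ^ p - algebraMap ℝ 𝒜 (s ^ p)) := by
  have hsa : IsSelfAdjoint a := .of_nonneg ha
  have hc : Continuous fun t : ℝ => t ^ p := Real.continuous_rpow_const hp0.le
  have h1 : a - algebraMap ℝ 𝒜 s = cfc (fun t : ℝ => t - s) a := by
    rw [cfc_sub (fun t : ℝ => t) (fun _ => s) a, cfc_id' ℝ a, cfc_const s a]
  have h2 : a ^ p - algebraMap ℝ 𝒜 (s ^ p) = cfc (fun t : ℝ => t ^ p - s ^ p) a := by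
    rw [cfc_sub (fun t : ℝ => t ^ p) (fun _ => s ^ p) a hc.continuousOn, cfc_const _ a,
      CFC.rpow_eq_cfc_real ha]
  rw [h1, h2, ← cfc_pow _ 2 a, ← cfc_smul _ _ a,
    ← cfc_mul _ _ a (by fun_prop) (by fun_prop)]
  refine cfc_mono fun t ht => ?_
  have ht0 : 0 ≤ t := spectrum_nonneg_of_nonneg ha ht
  have htM : t ≤ M :=
    (le_abs_self t).trans ((spectrum.norm_le_norm_mul_of_mem ht).trans haM)
  simpa using mul_sub_sq_le_sub_mul_rpow_sub hp0 hp1 hs ⟨ht0, htM⟩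

/-! ### The estimate for `T* T - |z|²` -/

theorem abs_re_inner_sub_re_inner_le {E : Type*} [NormedAddCommGroup E] [InnerProductSpace ℂ E]
    (S : E →L[ℂ] E) (y v : E) :
    |RCLike.re ⟪S y, y⟫_ℂ - RCLike.re ⟪S v, v⟫_ℂ| ≤ ‖S‖ * ‖y - v‖ * (‖y‖ + ‖v‖) := by
  have h : ⟪S y, y⟫_ℂ - ⟪S v, v⟫_ℂ = ⟪S (y - v), y⟫_ℂ + ⟪S v, y - v⟫_ℂ := by
    rw [map_sub, inner_sub_left, inner_sub_right]; ring
  rw [← map_sub, h]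
  refine (RCLike.abs_re_le_norm _).trans ((norm_add_le _ _).trans ?_)
  have h1 := (norm_inner_le_norm (𝕜 := ℂ) (S (y - v)) y).trans
    (mul_le_mul_of_nonneg_right (S.le_opNorm _) (norm_nonneg _))
  have h2 := (norm_inner_le_norm (𝕜 := ℂ) (S v) (y - v)).trans
    (mul_le_mul_of_nonneg_right (S.le_opNorm _) (norm_nonneg _))
  linarith

theorem norm_pow_apply_sub_le {E : Type*} [NormedAddCommGroup E] [NormedSpace ℂ E]
    (T : E →L[ℂ] E) (k : ℕ) (R : ℝ) : ∃ C, 0 ≤ C ∧ ∀ z : ℂ, ‖z‖ ≤ R → ∀ x : E,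
      ‖(T ^ k) x - z ^ k • x‖ ≤ C * ‖T x - z • x‖ := by
  induction k with
  | zero => exact ⟨0, le_rfl, fun z _ x => by simp⟩
  | succ k ih =>
    obtain ⟨C, hC, h⟩ := ih
    refine ⟨‖T ^ k‖ + |R| * C, by positivity, fun z hz x => ?_⟩
    have : (T ^ (k + 1)) x - z ^ (k + 1) • x
        = (T ^ k) (T x - z • x) + z • ((T ^ k) x - z ^ k • x) := by
      rw [pow_succ, mul_apply_eq_comp, map_sub, map_smul, pow_succ']
      module
    rw [this]
    refine (norm_add_le _ _).trans ?_
    rw [norm_smul, add_mul, mul_assoc]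
    gcongr
    · exact (T ^ k).le_opNorm _
    · exact hz.trans (le_abs_self R)
    · exact h z hz x

section

variable {H : Type*} [NormedAddCommGroup H] [InnerProductSpace ℂ H] [CompleteSpace H]

/-- An approximate eigenvector `x` of `T` for `z` at which `⟪(T* T) ^ p x, x⟫` dominates
`⟪(T T*) ^ p x, x⟫` is an approximate eigenvector of `T* T` for `|z|²`, with a bound uniform for
bounded `z`. The exponent `1/2` of `‖T x - z x‖` implied here suffices for property `(β)`. -/
theorem norm_sub_sq_smul_le (T : H →L[ℂ] H) {p : ℝ} (hp0 : 0 < p) (hp1 : p ≤ 1) (R : ℝ) :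
    ∃ C, 0 ≤ C ∧ ∀ z : ℂ, ‖z‖ ≤ R → ∀ x : H,
      0 ≤ RCLike.re ⟪((star T * T) ^ p - (T * star T) ^ p) x, x⟫_ℂ →
      ‖(star T * T) x - ((‖z‖ ^ 2 : ℝ) : ℂ) • x‖ ^ 2 ≤ C * ‖T x - z • x‖ * ‖x‖ := by
  set A := star T * T with hA
  set B := T * star T with hB
  set M := ‖A‖ * ‖(1 : H →L[ℂ] H)‖ + R ^ 2 + 1 with hM
  have hM0 : 0 < M := by positivity
  have hκ : 0 < p * M ^ (p - 1) := by positivity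
  refine ⟨(p * M ^ (p - 1))⁻¹ * ((‖B ^ p‖ + (R ^ 2) ^ p) * (‖T‖ + |R|)),
    by positivity, fun z hz x hx => ?_⟩
  set κ := p * M ^ (p - 1)
  have hzR : ‖z‖ ≤ |R| := hz.trans (le_abs_self R)
  set s := ‖z‖ ^ 2 with hs
  have hs0 : 0 ≤ s := by positivity
  have hsR : s ≤ R ^ 2 := by rw [hs, ← sq_abs R]; gcongr
  have hsM : s ∈ Set.Icc 0 M := ⟨hs0, by
    have : 0 ≤ ‖A‖ * ‖(1 : H →L[ℂ] H)‖ := by positivity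
    linarith⟩
  have hA0 : 0 ≤ A := star_mul_self_nonneg T
  -- The operator inequality `κ (A - s)² ≤ (A - s) (A ^ p - s ^ p)`, evaluated at `x` in `hmain`.
  have hop := smul_sub_sq_le_sub_mul_rpow_sub hA0 hp0 hp1 hsM (M := M)
    (by have := sq_nonneg R; linarith)
  rw [ContinuousLinearMap.le_def] at hop
  have hpos := hop.re_inner_nonneg_left x
  have halg (r : ℝ) (y : H) : algebraMap ℝ (H →L[ℂ] H) r y = (r : ℂ) • y := by
    rw [Algebra.algebraMap_eq_smul_one]; simp
  have hAin (y : H) : ⟪A y, x⟫_ℂ = ⟪T y, T x⟫_ℂ := by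
    rw [hA, mul_apply_eq_comp, ContinuousLinearMap.star_eq_adjoint,
      ContinuousLinearMap.adjoint_inner_left]
  have hAs : IsSelfAdjoint (A - algebraMap ℝ (H →L[ℂ] H) s) :=
    (IsSelfAdjoint.of_nonneg hA0).sub (.algebraMap _ (.all s))
  have hsq : ⟪((A - algebraMap ℝ (H →L[ℂ] H) s) ^ 2) x, x⟫_ℂ
      = ((‖A x - (s : ℂ) • x‖ ^ 2 : ℝ) : ℂ) := by
    rw [pow_two, mul_apply_eq_comp]
    nth_rewrite 1 [← hAs.star_eq]
    rw [ContinuousLinearMap.star_eq_adjoint, ContinuousLinearMap.adjoint_inner_left,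
      inner_self_eq_norm_sq_to_K, sub_apply, halg]
    simp
  have hTA : T ((A ^ p) x) = (B ^ p) (T x) := by
    simpa using DFunLike.congr_fun (mul_rpow_star_mul_self T hp0.le) x
  have hmain : κ * ‖A x - (s : ℂ) • x‖ ^ 2 ≤ RCLike.re ⟪(B ^ p) (T x), T x⟫_ℂ
      - s ^ p * ‖T x‖ ^ 2 - s * RCLike.re ⟪(A ^ p) x, x⟫_ℂ + s * s ^ p * ‖x‖ ^ 2 := by
    have hT2 : RCLike.re ⟪T x, T x⟫_ℂ = ‖T x‖ ^ 2 := inner_self_eq_norm_sq (𝕜 := ℂ) _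
    have hx2 : RCLike.re ⟪x, x⟫_ℂ = ‖x‖ ^ 2 := inner_self_eq_norm_sq (𝕜 := ℂ) _
    have hexp : RCLike.re ⟪((A - algebraMap ℝ (H →L[ℂ] H) s) *
        (A ^ p - algebraMap ℝ (H →L[ℂ] H) (s ^ p))) x, x⟫_ℂ
        = RCLike.re ⟪(B ^ p) (T x), T x⟫_ℂ
      - s ^ p * ‖T x‖ ^ 2 - s * RCLike.re ⟪(A ^ p) x, x⟫_ℂ + s * s ^ p * ‖x‖ ^ 2 := by
      rw [mul_apply_eq_comp, sub_apply, sub_apply,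
        halg, halg, map_sub, map_smul, smul_sub, inner_sub_left, inner_sub_left, inner_sub_left,
        inner_smul_left, inner_smul_left, inner_smul_left, inner_smul_left, hAin, hAin, hTA,
        Complex.conj_ofReal, Complex.conj_ofReal, ← hT2, ← hx2]
      simp only [RCLike.re_to_complex, Complex.sub_re, Complex.re_ofReal_mul]
      ring
    rw [sub_apply, inner_sub_left, map_sub, hexp,
      smul_apply, ← Complex.coe_smul, inner_smul_left, hsq,
      Complex.conj_ofReal, ← Complex.ofReal_mul] at hpos
    simp only [RCLike.re_to_complex, Complex.ofReal_re] at hpos ⊢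
    linarith
  have hsum : ‖T x‖ + ‖z • x‖ ≤ (‖T‖ + |R|) * ‖x‖ := by
    rw [norm_smul, add_mul]; gcongr; exact T.le_opNorm x
  -- Passing from `T x` to `z • x` costs `O(‖T x - z • x‖ ‖x‖)` in both quadratic forms.
  have hB1 := (abs_le.1 (abs_re_inner_sub_re_inner_le (B ^ p) (T x) (z • x))).2
  have hzB : RCLike.re ⟪(B ^ p) (z • x), z • x⟫_ℂ = s * RCLike.re ⟪(B ^ p) x, x⟫_ℂ := by
    rw [map_smul, inner_smul_left, inner_smul_right, ← mul_assoc, Complex.conj_mul', hs,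
      ← Complex.ofReal_pow]
    simp only [RCLike.re_to_complex, Complex.re_ofReal_mul]
  have hnorm : s * ‖x‖ ^ 2 - ‖T x‖ ^ 2 ≤ ‖T x - z • x‖ * (‖T x‖ + ‖z • x‖) := by
    have h1 : ‖z • x‖ - ‖T x‖ ≤ ‖T x - z • x‖ := by
      rw [norm_sub_rev]; exact norm_sub_norm_le _ _
    have h2 : s * ‖x‖ ^ 2 = ‖z • x‖ ^ 2 := by rw [norm_smul, mul_pow]
    rw [h2]
    calc _ = (‖z • x‖ - ‖T x‖) * (‖T x‖ + ‖z • x‖) := by ring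
      _ ≤ _ := by gcongr
  have hAB : s * RCLike.re ⟪(B ^ p) x, x⟫_ℂ ≤ s * RCLike.re ⟪(A ^ p) x, x⟫_ℂ := by
    rw [sub_apply, inner_sub_left, map_sub] at hx
    exact mul_le_mul_of_nonneg_left (by linarith) hs0
  rw [hzB] at hB1
  have hsp : s ^ p ≤ (R ^ 2) ^ p := by gcongr
  have hfin : κ * ‖A x - (s : ℂ) • x‖ ^ 2
      ≤ (‖B ^ p‖ + (R ^ 2) ^ p) * (‖T‖ + |R|) * ‖T x - z • x‖ * ‖x‖ := by
    calc κ * ‖A x - (s : ℂ) • x‖ ^ 2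
        ≤ ‖B ^ p‖ * ‖T x - z • x‖ * (‖T x‖ + ‖z • x‖)
          + s ^ p * (s * ‖x‖ ^ 2 - ‖T x‖ ^ 2) := by linarith
      _ ≤ ‖B ^ p‖ * ‖T x - z • x‖ * (‖T x‖ + ‖z • x‖)
          + s ^ p * (‖T x - z • x‖ * (‖T x‖ + ‖z • x‖)) := by gcongr
      _ = (‖B ^ p‖ + s ^ p) * ‖T x - z • x‖ * (‖T x‖ + ‖z • x‖) := by ring
      _ ≤ (‖B ^ p‖ + (R ^ 2) ^ p) * ‖T x - z • x‖ * ((‖T‖ + |R|) * ‖x‖) := by gcongr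
      _ = _ := by ring
  rw [mul_assoc, mul_assoc, inv_mul_eq_div, le_div_iff₀ hκ]
  linarith

theorem IsPKQuasihyponormal.re_inner_nonneg {p : ℝ} {k : ℕ} {T : H →L[ℂ] H}
    (hT : IsPKQuasihyponormal p k T) (x : H) :
    0 ≤ RCLike.re
      ⟪((star T * T) ^ p - (T * star T) ^ p) ((T ^ k) x), (T ^ k) x⟫_ℂ := by
  have h := ((ContinuousLinearMap.nonneg_iff_isPositive _).1 hT).re_inner_nonneg_left x
  rwa [← star_pow, mul_apply_eq_comp, mul_apply_eq_comp, ContinuousLinearMap.star_eq_adjoint (T ^ k),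
    ContinuousLinearMap.adjoint_inner_left] at h

/-! ### Cauchy estimates -/

/-- A Cauchy estimate for the non-analytic function `(A - |w|²) g(w)`. -/
theorem norm_mul_norm_le_of_sphere {E : Type*} [NormedAddCommGroup E] [NormedSpace ℂ E]
    [CompleteSpace E] (A : E →L[ℂ] E) {g : ℂ → E} {c : ℂ} {r b : ℝ} (hr : 0 < r)
    (hg : DiffContOnCl ℂ g (Metric.ball c r))
    (hb : ∀ w ∈ Metric.sphere c r, ‖A (g w) - ((‖w‖ ^ 2 : ℝ) : ℂ) • g w‖ ≤ b) :
    ‖c‖ * r * ‖g c‖ ≤ b := by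
  -- Cauchy's formula at `c` is applied to `F`, chosen analytic with `(w - c)⁻¹ • F w` equal to
  -- `(A - |w|²) g(w)` on the circle, where `|w|² = w * conj c + r² w / (w - c)`.
  set F : ℂ → E := fun w =>
    (w - c) • (A (g w) - (conj c * w) • g w) - ((r : ℂ) ^ 2 * w) • g w with hF
  have hFd : DiffContOnCl ℂ F (Metric.ball c r) := by
    have hid : DiffContOnCl ℂ (fun w : ℂ => w) (Metric.ball c r) := differentiable_id.diffContOnCl
    have hAg : DiffContOnCl ℂ (fun w => A (g w)) (Metric.ball c r) :=
      A.differentiable.comp_diffContOnCl hg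
    have hl (d : ℂ) : DiffContOnCl ℂ (fun w : ℂ => d * w) (Metric.ball c r) :=
      (differentiable_id.const_mul d).diffContOnCl
    exact ((hid.sub_const c).smul (hAg.sub ((hl _).smul hg))).sub ((hl _).smul hg)
  have hint := hFd.circleIntegral_sub_inv_smul (Metric.mem_ball_self hr)
  have hbound : ‖∮ w in C(c, r), (w - c)⁻¹ • F w‖ ≤ 2 * Real.pi * r * b := by
    refine circleIntegral.norm_integral_le_of_norm_le_const hr.le fun w hw => ?_
    have hwc : w - c ≠ 0 := by
      rw [← norm_ne_zero_iff, mem_sphere_iff_norm.1 hw]; exact hr.ne'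
    have hsq : (r : ℂ) ^ 2 = (w - c) * (conj w - conj c) := by
      rw [← map_sub, Complex.mul_conj, Complex.normSq_eq_norm_sq, mem_sphere_iff_norm.1 hw]
      norm_cast
    have : (w - c)⁻¹ • F w = A (g w) - ((‖w‖ ^ 2 : ℝ) : ℂ) • g w := by
      rw [← Complex.normSq_eq_norm_sq, ← Complex.mul_conj]
      simp only [hF, smul_sub, smul_smul, inv_mul_cancel_left₀ hwc, hsq, inv_mul_cancel₀ hwc,
        one_smul, ← mul_assoc]
      module
    rw [this]
    exact hb w hw
  rw [hint] at hbound
  have hFc : F c = -((r : ℂ) ^ 2 * c) • g c := by simp [hF]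
  rw [hFc, norm_smul, norm_smul] at hbound
  simp only [norm_mul, norm_neg, norm_pow, Complex.norm_real, Complex.norm_I, Complex.norm_ofNat,
    Real.norm_eq_abs, abs_of_pos hr, abs_of_pos Real.pi_pos, mul_one] at hbound
  refine le_of_mul_le_mul_left ?_ (show 0 < 2 * Real.pi * r by positivity)
  calc _ = 2 * Real.pi * (r ^ 2 * ‖c‖ * ‖g c‖) := by ring
    _ ≤ _ := hbound

/-- The self-improving form of `norm_mul_norm_le_of_sphere`: a bound of `(A - |w|²) g(w)` by
`(b ‖g w‖) ^ (1/2)` on a disc makes `‖g‖ ≤ C b` on the disc of half the radius, with `C`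
independent of `g`. -/
theorem norm_le_of_norm_sub_sq_smul_le {E : Type*} [NormedAddCommGroup E] [NormedSpace ℂ E]
    [CompleteSpace E] (A : E →L[ℂ] E) {g : ℂ → E} {c : ℂ} {ρ m b : ℝ} (hρ : 0 < ρ) (hm : 0 < m)
    (hb0 : 0 ≤ b)
    (hmc : ∀ w ∈ Metric.closedBall c ρ, m ≤ ‖w‖)
    (hg : DifferentiableOn ℂ g (Metric.closedBall c ρ))
    (hb : ∀ w ∈ Metric.closedBall c ρ,
      ‖A (g w) - ((‖w‖ ^ 2 : ℝ) : ℂ) • g w‖ ^ 2 ≤ b * ‖g w‖) :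
    ∀ w ∈ Metric.closedBall c (ρ / 2), ‖g w‖ ≤ 64 * b / (m ^ 2 * ρ ^ 2) := by
  -- The weight vanishes on the boundary and drops by a factor of at most `4` on the disc about
  -- `w₀` of half its distance to the boundary, so that `‖g‖` there is at most `4 ‖g w₀‖`.
  obtain ⟨w₀, hw₀, hmax⟩ := (isCompact_closedBall c ρ).exists_isMaxOn
    ⟨c, Metric.mem_closedBall_self hρ.le⟩
    (f := fun w => (ρ - dist w c) ^ 2 * ‖g w‖)
    (((continuous_const.sub (continuous_id.dist continuous_const)).pow 2).continuousOn.mul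
      hg.continuousOn.norm)
  set N := (ρ - dist w₀ c) ^ 2 * ‖g w₀‖ with hN
  have hmax' : ∀ w ∈ Metric.closedBall c ρ, (ρ - dist w c) ^ 2 * ‖g w‖ ≤ N := hmax
  suffices hNb : m ^ 2 * N ≤ 16 * b by
    intro w hw
    rw [Metric.mem_closedBall] at hw
    have h1 := hmax' w (Metric.mem_closedBall.2 (by linarith))
    have h2 : (ρ / 2) ^ 2 * ‖g w‖ ≤ (ρ - dist w c) ^ 2 * ‖g w‖ := by
      gcongr; linarith
    rw [le_div_iff₀ (by positivity)]
    have := mul_le_mul_of_nonneg_left (h2.trans h1) (sq_nonneg m)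
    linarith
  have hdw₀ : dist w₀ c ≤ ρ := hw₀
  rcases (show 0 ≤ N by positivity).eq_or_lt with hN0 | hN0
  · rw [← hN0]; linarith
  have hd : 0 < ρ - dist w₀ c := by
    refine (sub_nonneg.2 hdw₀).lt_of_ne fun h => hN0.ne' ?_
    rw [hN, ← h]; ring
  set d := ρ - dist w₀ c with hd_def
  have hball (w : ℂ) (hw : w ∈ Metric.closedBall w₀ (d / 2)) : d / 2 ≤ ρ - dist w c := by
    have := dist_triangle w w₀ c
    rw [Metric.mem_closedBall] at hw
    linarith
  have hsub : Metric.closedBall w₀ (d / 2) ⊆ Metric.closedBall c ρ := fun w hw => by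
    have := hball w hw
    rw [Metric.mem_closedBall]; linarith
  have hsphere : ∀ w ∈ Metric.sphere w₀ (d / 2),
      ‖A (g w) - ((‖w‖ ^ 2 : ℝ) : ℂ) • g w‖ ≤ √(b * (4 * N / d ^ 2)) := by
    intro w hw
    have hw' := Metric.sphere_subset_closedBall hw
    refine Real.le_sqrt_of_sq_le ((hb w (hsub hw')).trans ?_)
    gcongr
    rw [le_div_iff₀ (by positivity)]
    have h1 : (d / 2) ^ 2 * ‖g w‖ ≤ (ρ - dist w c) ^ 2 * ‖g w‖ := by
      gcongr; exact hball w hw'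
    linarith [hmax' w (hsub hw')]
  have hcauchy := norm_mul_norm_le_of_sphere A (half_pos hd)
    ((hg.mono hsub).diffContOnCl_ball subset_rfl) hsphere
  have hle : m * (d / 2) * ‖g w₀‖ ≤ √(b * (4 * N / d ^ 2)) :=
    le_trans (by gcongr; exact hmc w₀ hw₀) hcauchy
  have hsq : (m * (d / 2) * ‖g w₀‖) ^ 2 ≤ b * (4 * N / d ^ 2) :=
    (Real.le_sqrt (by positivity) (by positivity)).1 hle
  refine le_of_mul_le_mul_right ?_ hN0
  calc m ^ 2 * N * N = 4 * d ^ 2 * (m * (d / 2) * ‖g w₀‖) ^ 2 := by rw [hN]; ring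
    _ ≤ 4 * d ^ 2 * (b * (4 * N / d ^ 2)) := by gcongr
    _ = 16 * b * N := by field_simp; ring

/-! ### Bishop's property -/

theorem HasBishopPropertyBeta.hasSingleValuedExtensionProperty {E : Type*} [NormedAddCommGroup E]
    [NormedSpace ℂ E] {T : E →L[ℂ] E} (hT : HasBishopPropertyBeta T) :
    HasSingleValuedExtensionProperty T := by
  intro D f hD hf h z hz
  have hu := hT D (fun _ => f) hD (fun _ => hf)
    (fun K hK _ => Metric.tendstoUniformlyOn_iff.2 fun ε hε =>
      Eventually.of_forall fun _ w hw => by simpa [h w (hK hw)] using hε)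
    {z} (Set.singleton_subset_iff.2 hz) isCompact_singleton
  exact tendsto_nhds_unique tendsto_const_nhds (hu.tendsto_at (Set.mem_singleton z))

/-- A quantitative form of property `(β)` near a point `c ≠ 0`. -/
theorem IsPKQuasihyponormal.exists_closedBall_norm_le {p : ℝ} (hp0 : 0 < p) (hp1 : p ≤ 1) {k : ℕ}
    {T : H →L[ℂ] H} (hT : IsPKQuasihyponormal p k T) {D : Set ℂ} (hD : IsOpen D) {c : ℂ}
    (hc : c ∈ D) (hc0 : c ≠ 0) :
    ∃ ρ > 0, Metric.closedBall c ρ ⊆ D ∧ ∃ L, 0 ≤ L ∧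
      ∀ (f : ℂ → H) (δ : ℝ), DifferentiableOn ℂ f (Metric.closedBall c ρ) →
        (∀ w ∈ Metric.closedBall c ρ, ‖T (f w) - w • f w‖ ≤ δ) →
        ∀ w ∈ Metric.closedBall c (ρ / 2), ‖f w‖ ≤ L * δ := by
  obtain ⟨ρ', hρ', hsub'⟩ := Metric.nhds_basis_closedBall.mem_iff.1 (hD.mem_nhds hc)
  have hc0' : 0 < ‖c‖ := norm_pos_iff.2 hc0
  set m := ‖c‖ / 2 with hm
  have hm0 : 0 < m := half_pos hc0'
  set ρ := min ρ' m with hρ_def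
  have hρ : 0 < ρ := lt_min hρ' hm0
  have hlow (w : ℂ) (hw : w ∈ Metric.closedBall c ρ) : m ≤ ‖w‖ := by
    rw [mem_closedBall_iff_norm'] at hw
    have := norm_sub_norm_le c w
    linarith [min_le_right ρ' m]
  have hup (w : ℂ) (hw : w ∈ Metric.closedBall c ρ) : ‖w‖ ≤ ‖c‖ + ρ :=
    norm_le_norm_add_const_of_dist_le hw
  obtain ⟨C₁, hC₁, h₁⟩ := norm_sub_sq_smul_le T hp0 hp1 (‖c‖ + ρ)
  obtain ⟨C₂, hC₂, h₂⟩ := norm_pow_apply_sub_le T k (‖c‖ + ρ)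
  refine ⟨ρ, hρ, (Metric.closedBall_subset_closedBall (min_le_left _ _)).trans hsub',
    (64 * (C₁ * ‖T ^ k‖) / (m ^ 2 * ρ ^ 2) + C₂) / m ^ k, by positivity,
    fun f δ hf hδ w hw => ?_⟩
  have hδ0 : 0 ≤ δ := (norm_nonneg _).trans (hδ c (Metric.mem_closedBall_self hρ.le))
  have hg := norm_le_of_norm_sub_sq_smul_le (star T * T) (g := fun w => (T ^ k) (f w))
    (b := C₁ * (‖T ^ k‖ * δ)) hρ hm0 (by positivity) hlow
    ((T ^ k).differentiable.comp_differentiableOn hf)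
    (fun w hw => by
      refine (h₁ w (hup w hw) _ (hT.re_inner_nonneg _)).trans ?_
      have hcomm : T ((T ^ k) (f w)) - w • (T ^ k) (f w) = (T ^ k) (T (f w) - w • f w) := by
        rw [map_sub, map_smul, ← mul_apply_eq_comp, ← mul_apply_eq_comp,
          (Commute.self_pow T k).eq]
      gcongr
      rw [hcomm]
      exact ((T ^ k).le_opNorm _).trans (by gcongr; exact hδ w hw))
    w hw
  have hw' := Metric.closedBall_subset_closedBall (half_le_self hρ.le) hw
  have hpow : ‖w ^ k • f w‖ ≤ 64 * (C₁ * (‖T ^ k‖ * δ)) / (m ^ 2 * ρ ^ 2) + C₂ * δ := by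
    have h3 := (h₂ w (hup w hw') (f w)).trans (mul_le_mul_of_nonneg_left (hδ w hw') hC₂)
    have h4 := norm_sub_norm_le (w ^ k • f w) ((T ^ k) (f w))
    rw [norm_sub_rev] at h4
    linarith
  rw [norm_smul, norm_pow] at hpow
  rw [div_mul_eq_mul_div, le_div_iff₀ (by positivity)]
  calc ‖f w‖ * m ^ k ≤ ‖w‖ ^ k * ‖f w‖ := by
        rw [mul_comm]; gcongr; exact hlow w hw'
    _ ≤ _ := hpow
    _ = _ := by ring

theorem IsPKQuasihyponormal.hasBishopPropertyBeta {p : ℝ} (hp0 : 0 < p) (hp1 : p ≤ 1) {k : ℕ}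
    {T : H →L[ℂ] H} (hT : IsPKQuasihyponormal p k T) : HasBishopPropertyBeta T := by
  intro D f hD hf hTf
  have hdiff (n : ℕ) : DifferentiableOn ℂ (f n) D := (hf n).differentiableOn
  have hloc : TendstoLocallyUniformlyOn f (fun _ => 0) atTop (D \ {0}) := by
    rw [Metric.tendstoLocallyUniformlyOn_iff]
    intro ε hε c hc
    obtain ⟨ρ, hρ, hsub, L, hL, h⟩ := hT.exists_closedBall_norm_le hp0 hp1 hD hc.1 hc.2
    refine ⟨Metric.closedBall c (ρ / 2), mem_nhdsWithin_of_mem_nhds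
      (Metric.closedBall_mem_nhds c (half_pos hρ)), ?_⟩
    filter_upwards [Metric.tendstoUniformlyOn_iff.1 (hTf _ hsub (isCompact_closedBall c ρ))
      (ε / (L + 1)) (by positivity)] with n hn w hw
    rw [dist_zero_left]
    refine (h (f n) (ε / (L + 1)) ((hdiff n).mono hsub)
      (fun v hv => by simpa only [dist_zero_left] using (hn v hv).le) w hw).trans_lt ?_
    rw [← mul_div_assoc, div_lt_iff₀ (by positivity)]
    linarith
  have hcpt : ∀ K ⊆ D \ {0}, IsCompact K → TendstoUniformlyOn f (fun _ => 0) atTop K :=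
    (tendstoLocallyUniformlyOn_iff_forall_isCompact (hD.sdiff isClosed_singleton)).1 hloc
  refine (tendstoLocallyUniformlyOn_iff_forall_isCompact hD).1 ?_
  rw [Metric.tendstoLocallyUniformlyOn_iff]
  intro ε hε c hc
  by_cases hc0 : c = 0
  · subst hc0
    obtain ⟨ρ, hρ, hsub⟩ := Metric.nhds_basis_closedBall.mem_iff.1 (hD.mem_nhds hc)
    refine ⟨Metric.closedBall 0 ρ, mem_nhdsWithin_of_mem_nhds
      (Metric.closedBall_mem_nhds 0 hρ), ?_⟩
    have hsph : Metric.sphere (0 : ℂ) ρ ⊆ D \ {0} := fun w hw =>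
      ⟨hsub (Metric.sphere_subset_closedBall hw), Metric.ne_of_mem_sphere hw hρ.ne'⟩
    filter_upwards [Metric.tendstoUniformlyOn_iff.1 (hcpt _ hsph (isCompact_sphere 0 ρ))
      (ε / 2) (half_pos hε)] with n hn w hw
    rw [dist_zero_left]
    refine lt_of_le_of_lt (Complex.norm_le_of_forall_mem_frontier_norm_le
      (U := Metric.ball (0 : ℂ) ρ) Metric.isBounded_ball
      (((hdiff n).mono hsub).diffContOnCl_ball subset_rfl) (fun v hv => ?_) ?_) (half_lt_self hε)
    · rw [frontier_ball _ hρ.ne'] at hv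
      simpa using (hn v hv).le
    · rwa [closure_ball _ hρ.ne']
  · obtain ⟨t, ht, h⟩ := Metric.tendstoLocallyUniformlyOn_iff.1 hloc ε hε c ⟨hc, hc0⟩
    refine ⟨t, ?_, h⟩
    rw [(hD.sdiff isClosed_singleton).nhdsWithin_eq ⟨hc, hc0⟩] at ht
    exact mem_nhdsWithin_of_mem_nhds ht

end

theorem lemma2p4 {H : Type*} [NormedAddCommGroup H] [InnerProductSpace ℂ H] [CompleteSpace H]
    (p : ℝ) (hp0 : 0 < p) (hp1 : p ≤ 1) (k : ℕ) (T : H →L[ℂ] H)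
    (hT : IsPKQuasihyponormal p k T) :
    HasBishopPropertyBeta T ∧ HasSingleValuedExtensionProperty T := by
  have hβ := hT.hasBishopPropertyBeta hp0 hp1
  exact ⟨hβ, hβ.hasSingleValuedExtensionProperty⟩
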